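/- Let $r\ge 1$ and let $S\in C^2(\mathbb R^{r+1})$, $S=S(\xi_0,\dots,\xi_r)$, be a local energy with weak twist, that is: (1) $S(\xi_0+1,\dots,\xi_r+1)=S(\xi_0,\dots,\xi_r)$; (2) all second partial derivatives of $S$ are bounded by a constant $K$; (3) $S(\xi)\to\infty$ as $\max_j|\xi_0-\xi_j|\to\infty$; (4) $\partial_{j,k}S\le 0$ everywhere for all $j\ne k$, and there is $\lambda>0$ with $\partial_{0,1}S\le-\lambda$ everywhere. For $x\in\mathbb R^{\mathbb Z}$ put $S_i(x)=S(x_i,\dots,x_{i+r})$, and for $k,l\in\mathbb Z$ let $(\tau_{k,l}x)_i=x_{i-k}+l$. Write $x\le y$ if $x_i\le y_i$ for all $i$, and $x<y$ if $x\le y$ and $x\ne y$. Limits of sequences in $\mathbb R^{\mathbb Z}$ are pointwise. A sequence $x$ is a *global minimizer* if $\sum_{i=i_0-r}^{i_1}S_i(x)\le\sum_{i=i_0-r}^{i_1}S_i(x+v)$ for all integers $i_0\le i_1$ and all $v$ supported in $[i_0,i_1]$. It is *Birkhoff* if for all $k,l\in\mathbb Z$ one has $\tau_{k,l}x\le x$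 or $\tau_{k,l}x\ge x$. Its rotation number is $\lim_{n\to\pm\infty}x_n/n$. Let $p\ge1$ and $q$ be integers. Let $\mathcal M_{p,q}$ be the set of minimizers of $\sum_{i=1}^pS_i$ on the set of $p$-$q$-periodic sequences $\{x:\tau_{p,q}x=x\}$, and let $\mathcal{BM}^+_{q/p}$ be the set of Birkhoff global minimizers $x$ with rotation number $q/p$ and $\tau_{p,q}x\ge x$. **Theorem.** Let $x\in\mathcal{BM}^+_{q/p}\setminus\mathcal M_{p,q}$. Then the limits $x^+=\lim_{n\to\infty}\tau_{p,q}^nx$ and $x^-=\lim_{n\to\infty}\tau_{p,q}^{-n}x$ exist and belong to $\mathcal M_{p,q}$, and there is no $y\in\mathcal M_{p,q}$ with $x^-<y<x^+$. -/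

import Mathlib

open Filter Topology

namespace AubryMather

noncomputable section

/-- The second partial derivative `∂_{j,k} S` of a function of `r + 1` real variables. -/
def secondPartial {r : ℕ} (S : (Fin (r + 1) → ℝ) → ℝ) (j k : Fin (r + 1))
    (ξ : Fin (r + 1) → ℝ) : ℝ :=
  fderiv ℝ (fun η => fderiv ℝ S η (Pi.single k 1)) ξ (Pi.single j 1)

/-- A local energy of range `r ≥ 1` with the weak twist condition. The variables of `S` are
numbered `0, …, r`, so that the variable `0` of `S_i` is `x_i` and the variable `1` is `x_{i+1}`. -/
structure IsLocalEnergy (r : ℕ) (S : (Fin (r + 1) → ℝ) → ℝ) : Prop where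
  one_le_range : 1 ≤ r
  contDiff : ContDiff ℝ 2 S
  periodic : ∀ ξ : Fin (r + 1) → ℝ, S (fun i => ξ i + 1) = S ξ
  bounded : ∃ K : ℝ, 0 < K ∧ ∀ (j k : Fin (r + 1)) (ξ : Fin (r + 1) → ℝ),
    |secondPartial S j k ξ| ≤ K
  /-- `S ξ → ∞` as `max_j |ξ_0 - ξ_j| → ∞`. -/
  coercive : ∀ A : ℝ, ∃ R : ℝ, ∀ ξ : Fin (r + 1) → ℝ, (∃ j, R ≤ |ξ 0 - ξ j|) → A ≤ S ξ
  twist_nonpos : ∀ (j k : Fin (r + 1)), j ≠ k → ∀ ξ, secondPartial S j k ξ ≤ 0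
  twist_neg : ∃ l : ℝ, 0 < l ∧ ∀ ξ, secondPartial S 0 1 ξ ≤ -l

/-- `S_j(x) = S(x_j, …, x_{j+r})`. -/
def siteEnergy {r : ℕ} (S : (Fin (r + 1) → ℝ) → ℝ) (j : ℤ) (x : ℤ → ℝ) : ℝ :=
  S (fun k => x (j + (k : ℕ)))

/-- `∑_{i = a}^{b} S_i(x)`. -/
def action {r : ℕ} (S : (Fin (r + 1) → ℝ) → ℝ) (a b : ℤ) (x : ℤ → ℝ) : ℝ :=
  ∑ i ∈ Finset.Icc a b, siteEnergy S i x

/-- Global minimizers: `W_B(x) ≤ W_B(x + v)` for every segment `B = [i₀ - r, i₁]` with `i₀ ≤ i₁`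
and every variation `v` supported in its interior `[i₀, i₁]`. -/
def globalMinimizers {r : ℕ} (S : (Fin (r + 1) → ℝ) → ℝ) : Set (ℤ → ℝ) :=
  {x | ∀ i₀ i₁ : ℤ, i₀ ≤ i₁ → ∀ v : ℤ → ℝ, Function.support v ⊆ Set.Icc i₀ i₁ →
    action S (i₀ - r) i₁ x ≤ action S (i₀ - r) i₁ (x + v)}

/-- The translation `(τ_{k,l} x)_i = x_{i-k} + l`. -/
def translate (k l : ℤ) (x : ℤ → ℝ) : ℤ → ℝ := fun i => x (i - k) + l

/-- `p`-`q`-periodic sequences. -/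
def periodicSeqs (p q : ℤ) : Set (ℤ → ℝ) := {x | translate p q x = x}

/-- `M_{p,q}`: the minimizers of the periodic action `∑_{i=1}^p S_i` among the
`p`-`q`-periodic sequences (used for `p ≥ 1`). -/
def periodicMinimizers {r : ℕ} (S : (Fin (r + 1) → ℝ) → ℝ) (p q : ℤ) : Set (ℤ → ℝ) :=
  {x | x ∈ periodicSeqs p q ∧ ∀ u ∈ periodicSeqs p q, action S 1 p x ≤ action S 1 p u}

/-- Birkhoff sequences: ordered with respect to all their translates. -/
def IsBirkhoff (x : ℤ → ℝ) : Prop :=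
  ∀ k l : ℤ, translate k l x ≤ x ∨ x ≤ translate k l x

/-- `x_n / n → ρ` as `n → ±∞`. -/
def HasRotationNumber (x : ℤ → ℝ) (ρ : ℝ) : Prop :=
  Tendsto (fun n : ℤ => x n / n) atTop (𝓝 ρ) ∧ Tendsto (fun n : ℤ => x n / n) atBot (𝓝 ρ)

/-- `BM⁺_{q/p}`: the Birkhoff global minimizers `x` of rotation number `q / p` with
`τ_{p,q} x ≥ x`. -/
def birkhoffMinimizersPlus {r : ℕ} (S : (Fin (r + 1) → ℝ) → ℝ) (p q : ℤ) : Set (ℤ → ℝ) :=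
  {x | x ∈ globalMinimizers S ∧ IsBirkhoff x ∧ HasRotationNumber x ((q : ℝ) / p) ∧
    x ≤ translate p q x}

end

end AubryMather

namespace AubryMather

/-! Existence of the limits is monotonicity plus a bound: the translates of `x` by `(p, q)` are
ordered, and the Birkhoff property with the rotation number keeps them within distance 1 of `x`.
Global minimizers are closed under translation and limits, and a periodic global minimizer minimizes
the periodic action. For the gap, suppose `y` lies strictly between the limits. Strong comparison
makes both inequalities strict at every site, so `x` is above `y` far to the left and below it far
to the right. Then `x ⊓ y` runs from `y` to `x` and `x ⊔ y` from `x` to `y`. Submodularity says that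
together they cost no more than `x` and `y`. But `x ⊓ y` touches `y` without being equal to it,
hence is not stationary, and changing one site saves a fixed amount of energy. Follow `x ⊔ y`, then
`n` periods later the improved `x ⊓ y`, and return to `x` far to the right. The detour inserts `n`
periods of `y` and drops `n` periods of `x` near its right limit. Both have the same minimal action,
so in the limit only the saving remains, contradicting minimality of `x`
(`IsLocalEnergy.not_between`). -/

/-- The window `(x_j, …, x_{j+r})` of a sequence. -/
def window (r : ℕ) (j : ℤ) (x : ℤ → ℝ) : Fin (r + 1) → ℝ := fun k => x (j + (k : ℕ))

/-- The first partial derivative `∂_k S`. -/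
noncomputable def partialDeriv {r : ℕ} (S : (Fin (r + 1) → ℝ) → ℝ) (k : Fin (r + 1))
    (ξ : Fin (r + 1) → ℝ) : ℝ :=
  fderiv ℝ S ξ (Pi.single k 1)

/-- The formal gradient `∂_i ∑_j S_j` at the site `i`. -/
noncomputable def siteGradient {r : ℕ} (S : (Fin (r + 1) → ℝ) → ℝ) (i : ℤ) (x : ℤ → ℝ) : ℝ :=
  ∑ k : Fin (r + 1), partialDeriv S k (window r (i - (k : ℕ)) x)

/-! ### Sums over integer intervals and periods. -/

section Sums

theorem sum_Ico_add_sum_Ico (f : ℤ → ℝ) {a b c : ℤ} (hab : a ≤ b) (hbc : b ≤ c) :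
    ∑ j ∈ Finset.Ico a b, f j + ∑ j ∈ Finset.Ico b c, f j = ∑ j ∈ Finset.Ico a c, f j := by
  rw [← Finset.sum_union (Finset.Ico_disjoint_Ico_consecutive a b c),
    Finset.Ico_union_Ico_eq_Ico hab hbc]

theorem sum_Ico_shift (f : ℤ → ℝ) (a b c : ℤ) :
    ∑ j ∈ Finset.Ico a b, f (j + c) = ∑ j ∈ Finset.Ico (a + c) (b + c), f j := by
  rw [← Finset.map_add_right_Ico, Finset.sum_map]
  rfl

theorem sum_Ico_period {f : ℤ → ℝ} {p : ℤ} (hp : 0 < p) (hf : ∀ j, f (j + p) = f j) (a : ℤ) :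
    ∑ j ∈ Finset.Ico a (a + p), f j = ∑ j ∈ Finset.Ico 1 (1 + p), f j := by
  have step : ∀ a : ℤ, ∑ j ∈ Finset.Ico (a + 1) (a + 1 + p), f j
      = ∑ j ∈ Finset.Ico a (a + p), f j := by
    intro a
    have h1 := sum_Ico_add_sum_Ico f (show a ≤ a + 1 by omega) (show a + 1 ≤ a + 1 + p by omega)
    have h2 := sum_Ico_add_sum_Ico f (show a ≤ a + p by omega) (show a + p ≤ a + 1 + p by omega)
    have h3 : ∑ j ∈ Finset.Ico (a + p) (a + 1 + p), f j = ∑ j ∈ Finset.Ico a (a + 1), f j := by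
      rw [← sum_Ico_shift]
      exact Finset.sum_congr rfl fun j _ => hf j
    linarith
  induction a using Int.inductionOn' (b := 1) with
  | zero => rfl
  | succ k _ ih => rw [step, ih]
  | pred k _ ih =>
    rw [← ih, ← step (k - 1)]
    simp

theorem sum_Ico_periods {f : ℤ → ℝ} {p : ℤ} (hp : 0 < p) (hf : ∀ j, f (j + p) = f j) (a : ℤ)
    (n : ℕ) :
    ∑ j ∈ Finset.Ico a (a + n * p), f j = n * ∑ j ∈ Finset.Ico 1 (1 + p), f j := by
  induction n with
  | zero => simp
  | succ n ih =>
    have h0 : 0 ≤ (n : ℤ) * p := by positivity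
    have e : a + ((n + 1 : ℕ) : ℤ) * p = a + n * p + p := by push_cast; ring
    rw [e, ← sum_Ico_add_sum_Ico f (show a ≤ a + n * p by omega)
      (show a + n * p ≤ a + n * p + p by omega), ih, sum_Ico_period hp hf (a + n * p)]
    push_cast
    ring

theorem action_eq_sum_Ico {r : ℕ} (S : (Fin (r + 1) → ℝ) → ℝ) (a b : ℤ) (x : ℤ → ℝ) :
    action S a b x = ∑ j ∈ Finset.Ico a (b + 1), siteEnergy S j x := by
  unfold action
  rfl

end Sums

/-! ### Invariance of the energy under translations. -/

section Energy

variable {r : ℕ} {S : (Fin (r + 1) → ℝ) → ℝ}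

theorem siteEnergy_congr {j : ℤ} {x y : ℤ → ℝ} (h : ∀ i, j ≤ i → i ≤ j + r → x i = y i) :
    siteEnergy S j x = siteEnergy S j y := by
  unfold siteEnergy
  congr 1
  ext k
  have := k.2
  exact h _ (by omega) (by omega)

theorem IsLocalEnergy.add_int (hS : IsLocalEnergy r S) (ξ : Fin (r + 1) → ℝ) (l : ℤ) :
    S (fun k => ξ k + l) = S ξ := by
  have hP : Function.Periodic S (fun _ => (1 : ℝ)) := hS.periodic
  have := hP.zsmul l ξ
  rw [← this]
  congr 1
  ext k
  simp

theorem IsLocalEnergy.siteEnergy_translate (hS : IsLocalEnergy r S) (k l j : ℤ) (x : ℤ → ℝ) :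
    siteEnergy S j (translate k l x) = siteEnergy S (j - k) x := by
  unfold siteEnergy translate
  rw [← hS.add_int (fun i : Fin (r + 1) => x (j - k + (i : ℕ))) l]
  congr 1
  ext i
  congr 2
  ring

theorem IsLocalEnergy.siteEnergy_periodic (hS : IsLocalEnergy r S) {p q : ℤ} {x : ℤ → ℝ}
    (hx : x ∈ periodicSeqs p q) (j : ℤ) : siteEnergy S (j + p) x = siteEnergy S j x := by
  have := hS.siteEnergy_translate p q (j + p) x
  rw [show translate p q x = x from hx] at this
  simpa using this

theorem IsLocalEnergy.sum_periods (hS : IsLocalEnergy r S) {p q : ℤ} (hp : 0 < p) {x : ℤ → ℝ}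
    (hx : x ∈ periodicSeqs p q) (a : ℤ) (n : ℕ) :
    ∑ j ∈ Finset.Ico a (a + n * p), siteEnergy S j x = n * action S 1 p x := by
  rw [sum_Ico_periods hp (hS.siteEnergy_periodic hx), action_eq_sum_Ico, add_comm]

theorem IsLocalEnergy.continuous_siteEnergy (hS : IsLocalEnergy r S) (j : ℤ) :
    Continuous (siteEnergy S j) := by
  have := hS.contDiff.continuous
  unfold siteEnergy
  fun_prop

theorem IsLocalEnergy.partialDeriv_add_int (hS : IsLocalEnergy r S) (ξ : Fin (r + 1) → ℝ) (l : ℤ)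
    (k : Fin (r + 1)) : partialDeriv S k (fun i => ξ i + l) = partialDeriv S k ξ := by
  unfold partialDeriv
  have h : (fun η : Fin (r + 1) → ℝ => S (η + fun _ => (l : ℝ))) = S :=
    funext fun η => hS.add_int η l
  have := fderiv_comp_add_right (𝕜 := ℝ) (f := S) (x := ξ) (fun _ => (l : ℝ))
  rw [h] at this
  rw [this]
  rfl

theorem translate_iterate (p q : ℤ) (n : ℕ) (x : ℤ → ℝ) :
    (translate p q)^[n] x = translate (n * p) (n * q) x := by
  induction n with
  | zero => ext i; simp [translate]
  | succ n ih =>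
    rw [Function.iterate_succ_apply', ih]
    ext i
    simp only [translate]
    push_cast
    rw [show i - p - n * p = i - (n + 1) * p by ring]
    ring

theorem translate_int_mul_of_mem {p q : ℤ} {x : ℤ → ℝ} (hx : x ∈ periodicSeqs p q) (m : ℤ) :
    translate (m * p) (m * q) x = x := by
  have h : ∀ i, x (i - p) + q = x i := fun i => congrFun (show translate p q x = x from hx) i
  induction m using Int.induction_on with
  | zero => ext i; simp [translate]
  | succ n ih =>
    ext i
    have := congrFun ih (i - p)
    simp only [translate] at this ⊢
    rw [← h i, ← this, show i - (n + 1) * p = i - p - n * p by ring]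
    push_cast
    ring
  | pred n ih =>
    ext i
    have h1 := congrFun ih i
    have h2 := h (i - (-n - 1) * p)
    simp only [translate] at h1 ⊢
    rw [show i - (-n - 1) * p - p = i - -n * p by ring] at h2
    push_cast at *
    linarith

end Energy

/-! ### Twist: submodularity, strong comparison, stationarity. -/

section Calculus

variable {r : ℕ} {S : (Fin (r + 1) → ℝ) → ℝ}

theorem fderiv_eq_sum_single (F : (Fin (r + 1) → ℝ) → ℝ) (ξ d : Fin (r + 1) → ℝ) :
    fderiv ℝ F ξ d = ∑ k, d k * fderiv ℝ F ξ (Pi.single k 1) := by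
  conv_lhs => rw [pi_eq_sum_univ' d]
  rw [map_sum]
  refine Finset.sum_congr rfl fun k _ => ?_
  rw [map_smul, smul_eq_mul]

theorem IsLocalEnergy.differentiable_partialDeriv (hS : IsLocalEnergy r S) (k : Fin (r + 1)) :
    Differentiable ℝ (partialDeriv S k) := by
  have h : ContDiff ℝ 1 (fderiv ℝ S) := hS.contDiff.fderiv_right (by norm_num)
  have h' := h.differentiable (by norm_num)
  unfold partialDeriv
  fun_prop

theorem IsLocalEnergy.secondPartial_comm (hS : IsLocalEnergy r S) (j k : Fin (r + 1))
    (ξ : Fin (r + 1) → ℝ) : secondPartial S j k ξ = secondPartial S k j ξ := by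
  have h : ContDiff ℝ 1 (fderiv ℝ S) := hS.contDiff.fderiv_right (by norm_num)
  have h' : DifferentiableAt ℝ (fderiv ℝ S) ξ := h.differentiable (by norm_num) ξ
  have key : ∀ j k : Fin (r + 1), secondPartial S j k ξ
      = fderiv ℝ (fderiv ℝ S) ξ (Pi.single j 1) (Pi.single k 1) := by
    intro j k
    unfold secondPartial
    rw [fderiv_clm_apply h' (differentiableAt_const _)]
    simp
  rw [key, key]
  exact (hS.contDiff.contDiffAt.isSymmSndFDerivAt (by simp)) _ _

/-- Along increasing directions that fix the variable `k`, the derivative `∂_k S` decreases, at the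
rate given by any bound for `∂_{l,k} S`. -/
theorem IsLocalEnergy.partialDeriv_sub_le (hS : IsLocalEnergy r S) {k l : Fin (r + 1)}
    (hlk : l ≠ k) {c : ℝ} (hc : ∀ ζ, secondPartial S l k ζ ≤ -c) {ξ η : Fin (r + 1) → ℝ}
    (hle : ξ ≤ η) (heq : ξ k = η k) :
    partialDeriv S k η - partialDeriv S k ξ ≤ -c * (η l - ξ l) := by
  have hd := hS.differentiable_partialDeriv k
  have hder : ∀ t : ℝ, HasDerivAt (fun t : ℝ => partialDeriv S k (ξ + t • (η - ξ)))
      (fderiv ℝ (partialDeriv S k) (ξ + t • (η - ξ)) (η - ξ)) t := by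
    intro t
    have h1 : HasDerivAt (fun t : ℝ => ξ + t • (η - ξ)) (η - ξ) t := by
      simpa using ((hasDerivAt_id t).smul_const (η - ξ)).const_add ξ
    exact (hd _).hasFDerivAt.comp_hasDerivAt t h1
  have hbound : ∀ t : ℝ, deriv (fun t : ℝ => partialDeriv S k (ξ + t • (η - ξ))) t
      ≤ -c * (η l - ξ l) := by
    intro t
    rw [(hder t).deriv, fderiv_eq_sum_single]
    rw [← Finset.add_sum_erase _ _ (Finset.mem_univ l)]
    have h1 : ∀ j ∈ Finset.univ.erase l, (η - ξ) j
        * fderiv ℝ (partialDeriv S k) (ξ + t • (η - ξ)) (Pi.single j 1) ≤ 0 := by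
      intro j _
      rcases eq_or_ne j k with rfl | hj
      · simp [heq]
      · exact mul_nonpos_of_nonneg_of_nonpos (by simpa using hle j)
          (hS.twist_nonpos j k hj (ξ + t • (η - ξ)))
    have h2 := Finset.sum_nonpos h1
    have h3 : (η - ξ) l * fderiv ℝ (partialDeriv S k) (ξ + t • (η - ξ)) (Pi.single l 1)
        ≤ (η - ξ) l * -c :=
      mul_le_mul_of_nonneg_left (hc _) (by simpa using hle l)
    have h4 : (η - ξ) l * -c = -c * (η l - ξ l) := by simp; ring
    linarith
  have := image_sub_le_mul_sub_of_deriv_le (fun t => (hder t).differentiableAt) hbound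
    (zero_le_one (α := ℝ))
  simpa using this

theorem IsLocalEnergy.partialDeriv_anti (hS : IsLocalEnergy r S) {k : Fin (r + 1)}
    {ξ η : Fin (r + 1) → ℝ} (hle : ξ ≤ η) (heq : ξ k = η k) :
    partialDeriv S k η ≤ partialDeriv S k ξ := by
  have hr := hS.one_le_range
  -- The rate bound needs some variable other than `k`; `1 ≤ r` provides one, and weak twist allows
  -- the rate 0.
  have : Nontrivial (Fin (r + 1)) := Fin.nontrivial_iff_two_le.2 (by omega)
  obtain ⟨l, hl⟩ := exists_ne k
  have := hS.partialDeriv_sub_le hl (c := 0) (by simpa using hS.twist_nonpos l k hl) hle heq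
  linarith

/-- Submodularity from nonpositive mixed derivatives: with `b = η - ξ ⊓ η`, the increment of `S`
along `b` is at most as large from `ξ` as from the lower point `ξ ⊓ η`. -/
theorem IsLocalEnergy.inf_add_sup_le (hS : IsLocalEnergy r S) (ξ η : Fin (r + 1) → ℝ) :
    S (ξ ⊓ η) + S (ξ ⊔ η) ≤ S ξ + S η := by
  set m := ξ ⊓ η with hm
  set b := η - m with hb
  have hb0 : 0 ≤ b := by rw [hb, sub_nonneg, hm]; exact inf_le_right
  have hmx : m ≤ ξ := inf_le_left
  have hsup : ξ + b = ξ ⊔ η := by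
    rw [hb, ← add_sub_assoc, ← inf_add_sup ξ η, ← hm, add_sub_cancel_left]
  have hS1 := hS.contDiff.differentiable (by norm_num)
  have hder : ∀ (ζ : Fin (r + 1) → ℝ) (t : ℝ), HasDerivAt (fun t : ℝ => S (ζ + t • b))
      (fderiv ℝ S (ζ + t • b) b) t := by
    intro ζ t
    have h1 : HasDerivAt (fun t : ℝ => ζ + t • b) b t := by
      simpa using ((hasDerivAt_id t).smul_const b).const_add ζ
    exact (hS1 _).hasFDerivAt.comp_hasDerivAt t h1
  have hdiff := fun t => (hder ξ t).sub (hder m t)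
  have hbound : ∀ t : ℝ, deriv (fun t : ℝ => S (ξ + t • b) - S (m + t • b)) t ≤ 0 := by
    intro t
    rw [show deriv (fun t : ℝ => S (ξ + t • b) - S (m + t • b)) t = _ from (hdiff t).deriv,
      fderiv_eq_sum_single, fderiv_eq_sum_single, ← Finset.sum_sub_distrib]
    refine Finset.sum_nonpos fun k _ => ?_
    rw [← mul_sub]
    -- Either the two base points agree in coordinate `k`, as monotonicity of `∂_k S` requires, or
    -- `b k = 0`.
    rcases le_total (ξ k) (η k) with h | h
    · refine mul_nonpos_of_nonneg_of_nonpos (hb0 k) (sub_nonpos.2 ?_)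
      refine hS.partialDeriv_anti (add_le_add_left hmx _) ?_
      simp [hm, h]
    · have : b k = 0 := by simp [hb, hm, h]
      simp [this]
  have := image_sub_le_mul_sub_of_deriv_le (fun t => (hdiff t).differentiableAt) hbound
    (zero_le_one (α := ℝ))
  have hmb : m + b = η := by simp [hb]
  simp [hsup, hmb] at this
  linarith

theorem IsLocalEnergy.siteEnergy_inf_add_sup_le (hS : IsLocalEnergy r S) (j : ℤ) (x y : ℤ → ℝ) :
    siteEnergy S j (x ⊓ y) + siteEnergy S j (x ⊔ y) ≤ siteEnergy S j x + siteEnergy S j y :=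
  hS.inf_add_sup_le (window r j x) (window r j y)

/-- The strong comparison principle for stationary sequences. -/
theorem IsLocalEnergy.eq_of_le_of_stationary (hS : IsLocalEnergy r S) {x y : ℤ → ℝ}
    (hx : ∀ i, siteGradient S i x = 0) (hy : ∀ i, siteGradient S i y = 0) (hle : x ≤ y) {i₀ : ℤ}
    (h₀ : x i₀ = y i₀) : x = y := by
  have hr := hS.one_le_range
  obtain ⟨c, hc, htw⟩ := hS.twist_neg
  have h1 : ((1 : Fin (r + 1)) : ℕ) = 1 := by
    rw [Fin.val_one']
    exact Nat.mod_eq_of_lt (by omega)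
  have h01 : (0 : Fin (r + 1)) ≠ 1 := by
    intro h
    have := congrArg Fin.val h
    rw [h1] at this
    simp at this
  have step : ∀ i, x i = y i → x (i + 1) = y (i + 1) ∧ x (i - 1) = y (i - 1) := by
    intro i hi
    have hwin : ∀ j, window r j x ≤ window r j y := fun j k => hle _
    have hk : ∀ k : Fin (r + 1), window r (i - (k : ℕ)) x k = window r (i - (k : ℕ)) y k := by
      intro k
      simpa [window] using hi
    have hle' : ∀ k ∈ Finset.univ, partialDeriv S k (window r (i - (k : ℕ)) y)
        ≤ partialDeriv S k (window r (i - (k : ℕ)) x) :=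
      fun k _ => hS.partialDeriv_anti (hwin _) (hk k)
    -- Both gradients vanish and are ordered term by term, so every term agrees. The terms `k = 0`
    -- and `k = 1` then control the right and left neighbours through the strict twist.
    have heq := (Finset.sum_eq_sum_iff_of_le hle').1 ((hy i).trans (hx i).symm)
    have e0 := hS.partialDeriv_sub_le (k := 0) (l := 1) h01.symm (c := c)
      (fun ζ => by rw [hS.secondPartial_comm]; exact htw ζ) (hwin _) (hk 0)
    have e1 := hS.partialDeriv_sub_le (k := 1) (l := 0) h01 htw (hwin _) (hk 1)
    rw [heq _ (Finset.mem_univ _), sub_self] at e0 e1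
    simp only [window, h1, Fin.val_zero, Nat.cast_zero, Nat.cast_one, sub_zero, add_zero] at e0 e1
    have g0 := hle (i + 1)
    have g1 := hle (i - 1)
    constructor <;> nlinarith
  ext i
  induction i using Int.inductionOn' (b := i₀) with
  | zero => exact h₀
  | succ k _ ih => exact (step k ih).1
  | pred k _ ih => exact (step k ih).2

theorem IsLocalEnergy.hasDerivAt_sum (hS : IsLocalEnergy r S) (J : Finset ℤ) (z v : ℤ → ℝ) :
    HasDerivAt (fun t : ℝ => ∑ j ∈ J, siteEnergy S j (z + t • v))
      (∑ k : Fin (r + 1), ∑ j ∈ J, v (j + (k : ℕ)) * partialDeriv S k (window r j z)) 0 := by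
  have hS1 := hS.contDiff.differentiable (by norm_num)
  rw [Finset.sum_comm]
  refine HasDerivAt.fun_sum fun j _ => ?_
  have h1 : HasDerivAt (fun t : ℝ => window r j z + t • window r j v) (window r j v) 0 := by
    simpa using ((hasDerivAt_id (0 : ℝ)).smul_const (window r j v)).const_add (window r j z)
  have h2 := (hS1 (window r j z + (0 : ℝ) • window r j v)).hasFDerivAt.comp_hasDerivAt 0 h1
  rw [zero_smul, add_zero, fderiv_eq_sum_single] at h2
  exact h2

/-- Only the terms with `i - r ≤ j ≤ i` see the site `i`, so this finite window yields the whole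
formal gradient. -/
theorem IsLocalEnergy.hasDerivAt_sum_single (hS : IsLocalEnergy r S) (z : ℤ → ℝ) (i : ℤ) :
    HasDerivAt (fun t : ℝ => ∑ j ∈ Finset.Ico (i - r) (i + 1),
      siteEnergy S j (z + t • Pi.single i 1)) (siteGradient S i z) 0 := by
  convert hS.hasDerivAt_sum (Finset.Ico (i - r) (i + 1)) z (Pi.single i 1) using 1
  refine Finset.sum_congr rfl fun k _ => ?_
  have := k.2
  rw [Finset.sum_eq_single (i - (k : ℕ))]
  · simp
  · intro j _ hj
    rw [Pi.single_eq_of_ne (by omega), zero_mul]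
  · intro h
    rw [Finset.mem_Ico] at h
    omega

theorem IsLocalEnergy.partialDeriv_window_add_mul (hS : IsLocalEnergy r S) {p q : ℤ} {x : ℤ → ℝ}
    (hx : x ∈ periodicSeqs p q) (k : Fin (r + 1)) (j m : ℤ) :
    partialDeriv S k (window r (j - m * p) x) = partialDeriv S k (window r j x) := by
  rw [← hS.partialDeriv_add_int _ (m * q)]
  congr 1
  ext i
  have := congrFun (translate_int_mul_of_mem hx m) (j + (i : ℕ))
  simp only [translate] at this
  simp only [window]
  rw [← this]
  congr 2
  ring

/-- The periodic variation supported on `i + pℤ` is admissible, and the derivative of the periodic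
action along it is the formal gradient at `i`. -/
theorem IsLocalEnergy.siteGradient_eq_zero_of_mem (hS : IsLocalEnergy r S) {p q : ℤ} (hp : 0 < p)
    {x : ℤ → ℝ} (hx : x ∈ periodicMinimizers S p q) (i : ℤ) : siteGradient S i x = 0 := by
  set v : ℤ → ℝ := fun j => if p ∣ i - j then 1 else 0 with hv
  have hmin : IsLocalMin (fun t : ℝ => ∑ j ∈ Finset.Icc 1 p, siteEnergy S j (x + t • v)) 0 := by
    refine Eventually.of_forall fun t => ?_
    have := hx.2 (x + t • v) ?_
    · simpa [action] using this
    · ext j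
      have h1 := congrFun (show translate p q x = x from hx.1) j
      simp only [translate] at h1
      have h2 : v (j - p) = v j := by
        simp only [hv]
        congr 1
        rw [show i - (j - p) = i - j + p by ring]
        simp
      simp only [translate, Pi.add_apply, Pi.smul_apply, smul_eq_mul, h2, ← h1]
      ring
  have h := hmin.hasDerivAt_eq_zero (hS.hasDerivAt_sum _ x v)
  rw [← h]
  refine Finset.sum_congr rfl fun k _ => ?_
  -- The unique representative of `i - k` modulo `p` in `[1, p]`: the only term where the variation
  -- meets variable `k`.
  set j₀ : ℤ := (i - (k : ℕ) - 1) % p + 1 with hj₀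
  have hmod := Int.emod_nonneg (i - (k : ℕ) - 1) hp.ne'
  have hmod' := Int.emod_lt_of_pos (i - (k : ℕ) - 1) hp
  have hdiv := Int.emod_add_mul_ediv (i - (k : ℕ) - 1) p
  set m : ℤ := (i - (k : ℕ) - 1) / p with hm
  have hj₀' : j₀ = i - (k : ℕ) - m * p := by rw [hj₀]; linarith
  rw [Finset.sum_eq_single j₀]
  · have : p ∣ i - (j₀ + (k : ℕ)) := ⟨m, by rw [hj₀']; ring⟩
    rw [show v (j₀ + (k : ℕ)) = 1 from if_pos this, one_mul, hj₀']
    exact (hS.partialDeriv_window_add_mul hx.1 k _ m).symm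
  · intro j hj hne
    rw [Finset.mem_Icc] at hj
    have : ¬ p ∣ i - (j + (k : ℕ)) := by
      rintro ⟨m', hm'⟩
      apply hne
      have hd : p ∣ j - j₀ := ⟨m - m', by rw [hj₀']; linarith⟩
      have := Int.eq_zero_of_abs_lt_dvd hd (by rw [abs_lt]; omega)
      omega
    simp [hv, this]
  · intro h
    rw [Finset.mem_Icc] at h
    omega

end Calculus

/-! ### Global minimizers and periodic minimizers. -/

section Minimizers

variable {r : ℕ} {S : (Fin (r + 1) → ℝ) → ℝ}

theorem IsLocalEnergy.translate_mem_globalMinimizers (hS : IsLocalEnergy r S) {x : ℤ → ℝ}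
    (hx : x ∈ globalMinimizers S) (k l : ℤ) : translate k l x ∈ globalMinimizers S := by
  intro i₀ i₁ hi v hv
  have hv' : Function.support (fun i => v (i + k)) ⊆ Set.Icc (i₀ - k) (i₁ - k) := by
    intro i h
    have := hv (show i + k ∈ Function.support v from h)
    simp only [Set.mem_Icc] at this ⊢
    omega
  have h := hx (i₀ - k) (i₁ - k) (by omega) _ hv'
  have key : ∀ u : ℤ → ℝ, action S (i₀ - r) i₁ (translate k l u)
      = action S (i₀ - k - r) (i₁ - k) u := by
    intro u
    simp only [action_eq_sum_Ico, hS.siteEnergy_translate]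
    have := sum_Ico_shift (fun j => siteEnergy S j u) (i₀ - r) (i₁ + 1) (-k)
    simp only [← sub_eq_add_neg] at this
    rw [this]
    congr 2 <;> ring
  rw [key]
  refine h.trans_eq ?_
  rw [← key]
  congr 1
  ext i
  simp [translate]
  ring

theorem IsLocalEnergy.mem_globalMinimizers_of_tendsto (hS : IsLocalEnergy r S) {u : ℕ → ℤ → ℝ}
    {x : ℤ → ℝ} (hu : ∀ n, u n ∈ globalMinimizers S) (h : Tendsto u atTop (𝓝 x)) :
    x ∈ globalMinimizers S := by
  intro i₀ i₁ hi v hv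
  have hc : Continuous (action S (i₀ - r) i₁) :=
    continuous_finsetSum _ fun j _ => hS.continuous_siteEnergy j
  exact le_of_tendsto_of_tendsto' ((hc.tendsto x).comp h)
    ((hc.tendsto (x + v)).comp (h.add_const v)) fun n => hu n i₀ i₁ hi v hv

theorem globalMinimizers_le {x u : ℤ → ℝ} (hx : x ∈ globalMinimizers S) {i₀ i₁ : ℤ} (hi : i₀ ≤ i₁)
    (hu : ∀ i, i < i₀ ∨ i₁ < i → u i = x i) :
    ∑ j ∈ Finset.Ico (i₀ - r) (i₁ + 1), siteEnergy S j x
      ≤ ∑ j ∈ Finset.Ico (i₀ - r) (i₁ + 1), siteEnergy S j u := by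
  have h := hx i₀ i₁ hi (u - x) ?_
  · rwa [add_sub_cancel, action_eq_sum_Ico, action_eq_sum_Ico] at h
  · intro i h
    by_contra hc
    rw [Set.mem_Icc, not_and_or, not_le, not_le] at hc
    exact h (by simp [hu i hc])

/-- A periodic global minimizer minimizes the periodic action. -/
theorem IsLocalEnergy.mem_periodicMinimizers (hS : IsLocalEnergy r S) {p q : ℤ} (hp : 0 < p)
    {x : ℤ → ℝ} (hx : x ∈ globalMinimizers S) (hxp : x ∈ periodicSeqs p q) :
    x ∈ periodicMinimizers S p q := by
  refine ⟨hxp, fun u hu => ?_⟩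
  -- Replace `n` periods of `x` by `u`. The junctions look like `f` on the left and a translate of
  -- `g` on the right, so they cost a constant `C` independent of `n`, while any gain per period
  -- grows linearly.
  set f : ℤ → ℝ := fun i => if i < 0 then x i else u i with hf
  set g : ℤ → ℝ := fun i => if i < 0 then u i else x i with hg
  set C : ℝ := ∑ j ∈ Finset.Ico (-(r : ℤ)) 0, siteEnergy S j f
    + ∑ j ∈ Finset.Ico (-(r : ℤ)) 0, siteEnergy S j g
    - ∑ j ∈ Finset.Ico (-(r : ℤ)) 0, siteEnergy S j u
    - ∑ j ∈ Finset.Ico (-(r : ℤ)) 0, siteEnergy S j x with hC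
  have key : ∀ n : ℕ, r + 1 ≤ n → n * (action S 1 p x - action S 1 p u) ≤ C := by
    intro n hn
    -- Long enough that no interaction window sees both junctions.
    have hnp : (r : ℤ) + 1 ≤ n * p := by
      have : (r : ℤ) + 1 ≤ n := by exact_mod_cast hn
      nlinarith
    have hxn := fun i => congrFun (translate_int_mul_of_mem hxp n) i
    have hun := fun i => congrFun (translate_int_mul_of_mem hu n) i
    simp only [translate] at hxn hun
    set U : ℤ → ℝ := fun i => if i < 0 ∨ n * p - 1 < i then x i else u i with hU
    have h := globalMinimizers_le hx (i₀ := 0) (i₁ := n * p - 1) (u := U) (by omega)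
      fun i hi => if_pos hi
    rw [zero_sub, sub_add_cancel] at h
    rw [← sum_Ico_add_sum_Ico _ (show -(r : ℤ) ≤ 0 by omega) (show 0 ≤ n * p by omega),
      ← sum_Ico_add_sum_Ico _ (show -(r : ℤ) ≤ 0 by omega) (show 0 ≤ n * p by omega),
      ← sum_Ico_add_sum_Ico (fun j => siteEnergy S j U) (show 0 ≤ n * p - r by omega)
        (show n * p - r ≤ n * p by omega)] at h
    have hx1 := hS.sum_periods hp hxp 0 n
    have hu1 := hS.sum_periods hp hu (-r) n
    rw [zero_add] at hx1
    rw [show -(r : ℤ) + n * p = n * p - r by ring,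
      ← sum_Ico_add_sum_Ico _ (show -(r : ℤ) ≤ 0 by omega) (show 0 ≤ n * p - r by omega)] at hu1
    have e1 : ∑ j ∈ Finset.Ico (-(r : ℤ)) 0, siteEnergy S j U
        = ∑ j ∈ Finset.Ico (-(r : ℤ)) 0, siteEnergy S j f := by
      refine Finset.sum_congr rfl fun j hj => siteEnergy_congr fun i h1 h2 => ?_
      rw [Finset.mem_Ico] at hj
      have : ¬ n * p - 1 < i := by omega
      simp only [hU, hf, this, or_false]
    have e2 : ∑ j ∈ Finset.Ico 0 (n * p - r), siteEnergy S j U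
        = ∑ j ∈ Finset.Ico 0 (n * p - r), siteEnergy S j u := by
      refine Finset.sum_congr rfl fun j hj => siteEnergy_congr fun i h1 h2 => ?_
      rw [Finset.mem_Ico] at hj
      exact if_neg (by omega)
    have e3 : ∑ j ∈ Finset.Ico (n * p - r) (n * p), siteEnergy S j U
        = ∑ j ∈ Finset.Ico (-(r : ℤ)) 0, siteEnergy S j g := by
      have := sum_Ico_shift (fun j => siteEnergy S j U) (-r) 0 (n * p)
      rw [zero_add, show -(r : ℤ) + n * p = n * p - r by ring] at this
      rw [← this]
      refine Finset.sum_congr rfl fun j hj => ?_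
      rw [Finset.mem_Ico] at hj
      have ht := hS.siteEnergy_translate (n * p) (n * q) (j + n * p) g
      rw [add_sub_cancel_right] at ht
      rw [← ht]
      refine siteEnergy_congr fun i h1 h2 => ?_
      have h0 : ¬ i < 0 := by omega
      simp only [hU, hg, translate, h0, false_or]
      by_cases hi : n * p - 1 < i
      · rw [if_pos hi, if_neg (by omega), hxn]
      · rw [if_neg hi, if_pos (by omega), hun]
    rw [e1, e2, e3, hx1] at h
    rw [mul_sub, hC]
    linarith
  by_contra hlt
  rw [not_le, ← sub_pos] at hlt
  obtain ⟨N, hN⟩ := exists_nat_gt (C / (action S 1 p x - action S 1 p u))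
  rw [div_lt_iff₀ hlt] at hN
  have h1 := key (N + r + 1) (by omega)
  push_cast at h1
  nlinarith [(Nat.cast_nonneg r : (0 : ℝ) ≤ r)]

end Minimizers

/-! ### Monotone limits of translates. -/

section Limits

variable {p q : ℤ} {x : ℤ → ℝ}

theorem tendsto_natCast_mul_atTop (hp : 0 < p) :
    Tendsto (fun m : ℕ => (m : ℤ) * p) atTop atTop := by
  have h : Tendsto (fun m : ℕ => (m : ℤ)) atTop atTop := tendsto_natCast_atTop_atTop
  exact h.atTop_mul_const' hp

/-- Compare `x` with its translate by `(n p, n q - 1)`. If that translate were above `x`, iterating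
would force a rotation number at most `(n q - 1) / (n p) < q / p`. -/
theorem IsBirkhoff.translate_mul_le (hp : 0 < p) (hB : IsBirkhoff x)
    (hR : HasRotationNumber x ((q : ℝ) / p)) (n : ℕ) (i : ℤ) : x (i - n * p) + n * q ≤ x i + 1 := by
  rcases Nat.eq_zero_or_pos n with rfl | hn
  · simp
  have hP : 0 < n * p := by positivity
  rcases hB (n * p) (n * q - 1) with h | h
  · have := h i
    simp only [translate] at this
    push_cast at this
    linarith
  exfalso
  have hit : ∀ m : ℕ, x 0 ≤ x (-(m * (n * p))) + m * (n * q - 1) := by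
    intro m
    induction m with
    | zero => simp
    | succ m ih =>
      have := h (-(m * (n * p)))
      simp only [translate] at this
      rw [show -((m : ℤ) * (n * p)) - n * p = -((m + 1 : ℕ) * (n * p)) by push_cast; ring] at this
      push_cast at this ⊢
      linarith
  have hlim : Tendsto (fun m : ℕ => -((m : ℤ) * (n * p))) atTop atBot :=
    tendsto_neg_atTop_atBot.comp (tendsto_natCast_mul_atTop hP)
  have h1 := hR.2.comp hlim
  have hp' : (0 : ℝ) < p := by exact_mod_cast hp
  have hn' : (0 : ℝ) < n := by exact_mod_cast hn
  have h2 : Tendsto (fun m : ℕ => (n * q - 1 - x 0 / m) / (n * p : ℝ)) atTop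
      (𝓝 ((n * q - 1 - 0) / (n * p : ℝ))) :=
    ((tendsto_const_div_atTop_nhds_zero_nat (x 0)).const_sub _).div_const _
  have h3 : (q : ℝ) / p ≤ (n * q - 1 - 0) / (n * p : ℝ) := by
    refine le_of_tendsto_of_tendsto h1 h2 ?_
    filter_upwards [eventually_gt_atTop 0] with m hm
    have hm' : (0 : ℝ) < m := by exact_mod_cast hm
    simp only [Function.comp]
    push_cast
    have := hit m
    rw [div_neg, ← neg_div, div_le_div_iff₀ (by positivity) (by positivity)]
    have e : (n * q - 1 - x 0 / m) * (m * (n * p : ℝ)) = (m * (n * q - 1) - x 0) * (n * p) := by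
      field_simp
    rw [e]
    exact mul_le_mul_of_nonneg_right (by linarith) (by positivity)
  rw [div_le_div_iff₀ hp' (by positivity)] at h3
  nlinarith

theorem le_translate_iterate (h : x ≤ translate p q x) (n : ℕ) (i : ℤ) :
    x (i - n * p) + n * q ≤ x (i - (n + 1 : ℕ) * p) + (n + 1 : ℕ) * q := by
  have := h (i - n * p)
  simp only [translate] at this
  rw [show i - n * p - p = i - (n + 1 : ℕ) * p by push_cast; ring] at this
  push_cast at *
  linarith

theorem exists_tendsto_translate (hp : 0 < p) (hB : IsBirkhoff x)
    (hR : HasRotationNumber x ((q : ℝ) / p)) (h : x ≤ translate p q x) :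
    (∃ y, Tendsto (fun n : ℕ => (translate p q)^[n] x) atTop (𝓝 y)) ∧
      ∃ y, Tendsto (fun n : ℕ => (translate (-p) (-q))^[n] x) atTop (𝓝 y) := by
  have hb := hB.translate_mul_le hp hR
  simp only [translate_iterate, tendsto_pi_nhds]
  constructor
  · refine ⟨fun i => _, fun i => tendsto_atTop_ciSup (monotone_nat_of_le_succ fun n => ?_)
      ⟨x i + 1, ?_⟩⟩
    · simpa [translate] using le_translate_iterate h n i
    · rintro _ ⟨n, rfl⟩
      simpa [translate] using hb n i
  · refine ⟨fun i => _, fun i => tendsto_atTop_ciInf (antitone_nat_of_succ_le fun n => ?_)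
      ⟨x i - 1, ?_⟩⟩
    · have := h (i + (n + 1 : ℕ) * p)
      simp only [translate] at this ⊢
      rw [show i + (n + 1 : ℕ) * p - p = i + n * p by push_cast; ring] at this
      simp only [mul_neg, sub_neg_eq_add]
      push_cast at *
      linarith
    · rintro _ ⟨n, rfl⟩
      -- The lower bound for backward translates is the forward upper bound read at a shifted site.
      have := hb n (i + n * p)
      rw [add_sub_cancel_right] at this
      simp only [translate]
      simp only [mul_neg, sub_neg_eq_add]
      push_cast at *
      linarith

theorem continuous_translate (k l : ℤ) : Continuous (translate k l) := by
  unfold translate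
  fun_prop

theorem mem_periodicSeqs_of_tendsto {y : ℤ → ℝ}
    (h : Tendsto (fun n : ℕ => (translate p q)^[n] x) atTop (𝓝 y)) : y ∈ periodicSeqs p q := by
  have h1 := ((continuous_translate p q).tendsto y).comp h
  have h2 := h.comp (tendsto_add_atTop_nat 1)
  refine tendsto_nhds_unique h1 (h2.congr fun n => ?_)
  simp [Function.iterate_succ_apply']

theorem periodicSeqs_neg {y : ℤ → ℝ} (h : y ∈ periodicSeqs (-p) (-q)) : y ∈ periodicSeqs p q := by
  have := translate_int_mul_of_mem h (-1)
  rwa [neg_one_mul, neg_one_mul, neg_neg, neg_neg] at this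

theorem IsLocalEnergy.limit_mem_periodicMinimizers {r : ℕ} {S : (Fin (r + 1) → ℝ) → ℝ}
    (hS : IsLocalEnergy r S) {k l : ℤ} (hp : 0 < p) (hx : x ∈ globalMinimizers S)
    {y : ℤ → ℝ} (h : Tendsto (fun n : ℕ => (translate k l)^[n] x) atTop (𝓝 y))
    (hy : y ∈ periodicSeqs p q) : y ∈ periodicMinimizers S p q := by
  refine hS.mem_periodicMinimizers hp (hS.mem_globalMinimizers_of_tendsto (fun n => ?_) h) hy
  rw [translate_iterate]
  exact hS.translate_mem_globalMinimizers hx _ _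

/-- Finitely many residues modulo `p` give a common threshold for the strict inequality; periodicity
of `y` carries it to all sites far to the left. -/
theorem exists_forall_le_lt (hp : 0 < p) {y u : ℤ → ℝ} (hy : y ∈ periodicSeqs p q)
    (hlt : ∀ i, y i < u i)
    (h : ∀ i, Tendsto (fun m : ℕ => x (i - m * p) + m * q) atTop (𝓝 (u i))) :
    ∃ a, ∀ j ≤ a, y j < x j := by
  have hev : ∀ᶠ m : ℕ in atTop, ∀ i ∈ Finset.Ico 0 p, y i < x (i - m * p) + m * q :=
    (Finset.eventually_all _).2 fun i _ => (h i).eventually_const_lt (hlt i)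
  obtain ⟨M, hM⟩ := eventually_atTop.1 hev
  refine ⟨-M * p, fun j hj => ?_⟩
  have hd := Int.emod_add_mul_ediv j p
  have hle : j / p ≤ -M := by
    have := Int.ediv_le_ediv hp hj
    rwa [Int.mul_ediv_cancel _ hp.ne'] at this
  obtain ⟨m, hm⟩ := Int.eq_ofNat_of_zero_le (show 0 ≤ -(j / p) by omega)
  have h1 := hM m (by omega) (j % p)
    (Finset.mem_Ico.2 ⟨Int.emod_nonneg _ hp.ne', Int.emod_lt_of_pos _ hp⟩)
  have h2 := congrFun (translate_int_mul_of_mem hy m) (j % p)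
  have e : j % p - m * p = j := by
    rw [← hm]
    linarith
  simp only [translate] at h2
  rw [e] at h1 h2
  push_cast at *
  linarith

theorem exists_forall_ge_lt (hp : 0 < p) {y u : ℤ → ℝ} (hy : y ∈ periodicSeqs p q)
    (hlt : ∀ i, u i < y i)
    (h : ∀ i, Tendsto (fun m : ℕ => x (i + m * p) - m * q) atTop (𝓝 (u i))) :
    ∃ b, ∀ j, b ≤ j → x j < y j := by
  have hev : ∀ᶠ m : ℕ in atTop, ∀ i ∈ Finset.Ico 0 p, x (i + m * p) - m * q < y i :=
    (Finset.eventually_all _).2 fun i _ => (h i).eventually_lt_const (hlt i)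
  obtain ⟨M, hM⟩ := eventually_atTop.1 hev
  refine ⟨M * p, fun j hj => ?_⟩
  have hd := Int.emod_add_mul_ediv j p
  have hle : M ≤ j / p := by
    have := Int.ediv_le_ediv hp hj
    rwa [Int.mul_ediv_cancel _ hp.ne'] at this
  obtain ⟨m, hm⟩ := Int.eq_ofNat_of_zero_le (show 0 ≤ j / p by omega)
  have h1 := hM m (by omega) (j % p)
    (Finset.mem_Ico.2 ⟨Int.emod_nonneg _ hp.ne', Int.emod_lt_of_pos _ hp⟩)
  have h2 := congrFun (translate_int_mul_of_mem hy (-m)) (j % p)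
  have e : j % p + m * p = j := by
    rw [← hm]
    linarith
  simp only [translate] at h2
  rw [show j % p - -m * p = j % p + m * p by ring, e] at h2
  rw [e] at h1
  push_cast at *
  linarith

end Limits

/-! ### No periodic minimizer between the two limits. -/

section Gap

variable {r : ℕ} {S : (Fin (r + 1) → ℝ) → ℝ}

/-- A heteroclinic global minimizer from `xp` to `xm` passes no periodic minimizer in between. -/
theorem IsLocalEnergy.not_between (hS : IsLocalEnergy r S) {p q : ℤ} (hp : 0 < p)
    {x xm xp y : ℤ → ℝ} (hx : x ∈ globalMinimizers S) (hxm : xm ∈ periodicMinimizers S p q)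
    (hxp : xp ∈ periodicMinimizers S p q)
    (tp : ∀ i, Tendsto (fun m : ℕ => x (i - m * p) + m * q) atTop (𝓝 (xp i)))
    (tm : ∀ i, Tendsto (fun m : ℕ => x (i + m * p) - m * q) atTop (𝓝 (xm i)))
    (hy : y ∈ periodicMinimizers S p q) (hmy : xm < y) (hyp : y < xp) : False := by
  have hyG := hS.siteGradient_eq_zero_of_mem hp hy
  have hmlt : ∀ i, xm i < y i := fun i => (hmy.le i).lt_of_ne fun h =>
    hmy.ne (hS.eq_of_le_of_stationary (hS.siteGradient_eq_zero_of_mem hp hxm) hyG hmy.le h)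
  have hplt : ∀ i, y i < xp i := fun i => (hyp.le i).lt_of_ne fun h =>
    hyp.ne (hS.eq_of_le_of_stationary hyG (hS.siteGradient_eq_zero_of_mem hp hxp) hyp.le h)
  obtain ⟨a₀, ha₀⟩ := exists_forall_le_lt hp hy.1 hplt tp
  obtain ⟨b₀, hb₀⟩ := exists_forall_ge_lt hp hy.1 hmlt tm
  -- If `x ⊓ y` were stationary, touching `y` at `a₀` would force `x ⊓ y = y`, which fails at `b₀`.
  have hne : ∃ i, siteGradient S i (x ⊓ y) ≠ 0 := by
    by_contra! hc
    have h := hS.eq_of_le_of_stationary hc hyG inf_le_right (i₀ := a₀)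
      (by simpa using (ha₀ a₀ le_rfl).le)
    have h1 := congrFun h b₀
    have h2 := hb₀ b₀ le_rfl
    simp only [Pi.inf_apply, inf_eq_right] at h1
    exact absurd h1 (not_le.2 h2)
  obtain ⟨i₀, hi₀⟩ := hne
  -- Without such a `t`, the value `t = 0` would be a minimum and the derivative, the gradient at
  -- `i₀`, would vanish.
  have hgain : ∃ t : ℝ, ∑ j ∈ Finset.Ico (i₀ - r) (i₀ + 1),
      siteEnergy S j (x ⊓ y + t • Pi.single i₀ 1)
      < ∑ j ∈ Finset.Ico (i₀ - r) (i₀ + 1), siteEnergy S j (x ⊓ y) := by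
    by_contra! hc
    refine hi₀ (IsLocalMin.hasDerivAt_eq_zero (Eventually.of_forall fun t => ?_)
      (hS.hasDerivAt_sum_single (x ⊓ y) i₀))
    simpa using hc t
  obtain ⟨t, ht⟩ := hgain
  set z' : ℤ → ℝ := x ⊓ y + t • Pi.single i₀ 1 with hz'
  have hz'ne : ∀ i, i ≠ i₀ → z' i = (x ⊓ y) i := fun i hi => by simp [hz', hi]
  obtain ⟨a, haa, hai⟩ : ∃ a, a ≤ a₀ ∧ a < i₀ := ⟨min a₀ (i₀ - 1), by omega, by omega⟩
  obtain ⟨b, hbb, hbi⟩ : ∃ b, b₀ ≤ b ∧ i₀ < b := ⟨max b₀ (i₀ + 1), by omega, by omega⟩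
  have hza : ∀ i ≤ a, z' i = y i := fun i hi => by
    rw [hz'ne i (by omega)]
    exact inf_eq_right.2 (ha₀ i (by omega)).le
  have hzb : ∀ i, b ≤ i → (x ⊓ y) i = x i := fun i hi => inf_eq_left.2 (hb₀ i (by omega)).le
  have hzb' : ∀ i, b ≤ i → z' i = x i := fun i hi => by rw [hz'ne i (by omega), hzb i hi]
  have hwa : ∀ i ≤ a, (x ⊔ y) i = x i := fun i hi => sup_eq_left.2 (ha₀ i (by omega)).le
  have hwb : ∀ i, b ≤ i → (x ⊔ y) i = y i := fun i hi => sup_eq_right.2 (hb₀ i (by omega)).le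
  -- The overlap `[b, a + n p]` of the two pieces is then long enough for every interaction window
  -- near the gluing to lie in one piece.
  obtain ⟨n, hn⟩ : ∃ n : ℕ, b - a + r ≤ n * p := by
    refine ⟨(b - a + r).toNat, ?_⟩
    rw [Int.toNat_of_nonneg (by omega)]
    nlinarith
  have hyn := fun i => congrFun (translate_int_mul_of_mem hy.1 n) i
  -- `T` is the translate of `z'` that coincides with `x ⊔ y` on `[b, a + n p]`.
  set T : ℤ → ℝ := translate (n * p) (n * q) z' with hT
  have hTw : ∀ i, b ≤ i → i ≤ a + n * p → T i = (x ⊔ y) i := fun i h1 h2 => by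
    rw [hwb i h1, ← hyn i, hT]
    simp only [translate]
    rw [hza _ (by omega)]
  -- The competitor: `x ⊔ y` up to `b`, then `T`, then back to `x` after `m p`. It differs from `x`
  -- only within `[a + 1, m p]`.
  set X : ℕ → ℤ → ℝ := fun m i => if i ≤ m * p then if i ≤ b then (x ⊔ y) i else T i else x i
    with hX
  set c : ℤ := a + 1 - r with hc
  -- Minimality of `x` against `X m`, after submodularity cancels the middle part. What remains is
  -- the dropped end of `x` on the left, and `n` periods of `y` with the last `r` terms of `X m`
  -- minus the saving on the right, both ends moved to the origin.
  have hkey : ∀ᶠ m : ℕ in atTop,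
      ∑ j ∈ Finset.Ico (-(n * p) - r + 1 : ℤ) 1, siteEnergy S j (translate (-(m * p)) (-(m * q)) x)
      ≤ n * action S 1 p y
        + ∑ j ∈ Finset.Ico (-r + 1 : ℤ) 1, siteEnergy S j (translate (-(m * p)) (-(m * q)) (X m))
        - (∑ j ∈ Finset.Ico (i₀ - r) (i₀ + 1), siteEnergy S j (x ⊓ y)
          - ∑ j ∈ Finset.Ico (i₀ - r) (i₀ + 1), siteEnergy S j z') := by
    filter_upwards [(tendsto_natCast_mul_atTop hp).eventually_ge_atTop (b + r + n * p)] with m hm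
    have hmin := globalMinimizers_le hx (i₀ := a + 1) (i₁ := m * p) (u := X m) (by omega) (by
      rintro i (hi | hi)
      · simp only [hX]
        rw [if_pos (by omega), if_pos (by omega), hwa i (by omega)]
      · exact if_neg (by omega))
    rw [← hc] at hmin
    set e : ℤ := m * p - r + 1 - n * p with he
    have hshift : ∀ (u : ℤ → ℝ) (s : ℤ),
        ∑ j ∈ Finset.Ico s 1, siteEnergy S j (translate (-(m * p)) (-(m * q)) u)
        = ∑ j ∈ Finset.Ico (m * p + s) (m * p + 1), siteEnergy S j u := by
      intro u s
      simp only [hS.siteEnergy_translate, sub_neg_eq_add]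
      rw [sum_Ico_shift (fun j => siteEnergy S j u), add_comm s, add_comm 1]
    rw [hshift, hshift, show (m * p + (-(n * p) - r + 1) : ℤ) = e by omega,
      show (m * p + (-r + 1) : ℤ) = m * p - r + 1 by ring]
    have s1 := sum_Ico_add_sum_Ico (fun j => siteEnergy S j x) (show c ≤ e by omega)
      (show e ≤ m * p + 1 by omega)
    have s2 := sum_Ico_add_sum_Ico (fun j => siteEnergy S j (X m)) (show c ≤ b by omega)
      (show b ≤ m * p - r + 1 by omega)
    have s3 := sum_Ico_add_sum_Ico (fun j => siteEnergy S j (X m))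
      (show c ≤ m * p - r + 1 by omega) (show m * p - r + 1 ≤ m * p + 1 by omega)
    have s4 : ∑ j ∈ Finset.Ico c b, siteEnergy S j (X m)
        = ∑ j ∈ Finset.Ico c b, siteEnergy S j (x ⊔ y) := by
      refine Finset.sum_congr rfl fun j hj => siteEnergy_congr fun i h1 h2 => ?_
      rw [Finset.mem_Ico] at hj
      simp only [hX]
      rw [if_pos (by omega)]
      split_ifs with hib
      · rfl
      · exact hTw i (by omega) (by omega)
    have s5 : ∑ j ∈ Finset.Ico b (m * p - r + 1), siteEnergy S j (X m)
        = ∑ j ∈ Finset.Ico (b - n * p) e, siteEnergy S j z' := by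
      have h := sum_Ico_shift (fun j => siteEnergy S j z') b (m * p - r + 1) (-(n * p))
      rw [← sub_eq_add_neg, ← sub_eq_add_neg, ← he] at h
      rw [← h]
      refine Finset.sum_congr rfl fun j hj => ?_
      rw [Finset.mem_Ico] at hj
      rw [← sub_eq_add_neg, ← hS.siteEnergy_translate (n * p) (n * q)]
      refine siteEnergy_congr fun i h1 h2 => ?_
      simp only [hX]
      rw [if_pos (by omega)]
      split_ifs with hib
      · exact (hTw i (by omega) (by omega)).symm
      · rfl
    have s6 := sum_Ico_add_sum_Ico (fun j => siteEnergy S j z') (show b - n * p ≤ c by omega)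
      (show c ≤ e by omega)
    have s7 : ∑ j ∈ Finset.Ico (b - n * p) c, siteEnergy S j z'
        = ∑ j ∈ Finset.Ico (b - n * p) c, siteEnergy S j y := by
      refine Finset.sum_congr rfl fun j hj => siteEnergy_congr fun i h1 h2 => ?_
      rw [Finset.mem_Ico] at hj
      exact hza i (by omega)
    have s8 : ∀ u : ℤ → ℝ, ∑ j ∈ Finset.Ico c (i₀ - r), siteEnergy S j u
        + ∑ j ∈ Finset.Ico (i₀ - r) (i₀ + 1), siteEnergy S j u
        + ∑ j ∈ Finset.Ico (i₀ + 1) e, siteEnergy S j u = ∑ j ∈ Finset.Ico c e, siteEnergy S j u := by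
      intro u
      rw [sum_Ico_add_sum_Ico _ (by omega) (by omega), sum_Ico_add_sum_Ico _ (by omega) (by omega)]
    have s9 : ∑ j ∈ Finset.Ico c (i₀ - r), siteEnergy S j z'
        = ∑ j ∈ Finset.Ico c (i₀ - r), siteEnergy S j (x ⊓ y) := by
      refine Finset.sum_congr rfl fun j hj => siteEnergy_congr fun i h1 h2 => hz'ne i ?_
      rw [Finset.mem_Ico] at hj
      omega
    have s10 : ∑ j ∈ Finset.Ico (i₀ + 1) e, siteEnergy S j z'
        = ∑ j ∈ Finset.Ico (i₀ + 1) e, siteEnergy S j (x ⊓ y) := by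
      refine Finset.sum_congr rfl fun j hj => siteEnergy_congr fun i h1 h2 => hz'ne i ?_
      rw [Finset.mem_Ico] at hj
      omega
    have s11 := sum_Ico_add_sum_Ico (fun j => siteEnergy S j (x ⊓ y)) (show c ≤ b by omega)
      (show b ≤ e by omega)
    have s12 : ∑ j ∈ Finset.Ico b e, siteEnergy S j (x ⊓ y)
        = ∑ j ∈ Finset.Ico b e, siteEnergy S j x := by
      refine Finset.sum_congr rfl fun j hj => siteEnergy_congr fun i h1 h2 => hzb i ?_
      rw [Finset.mem_Ico] at hj
      omega
    have s13 : ∑ j ∈ Finset.Ico c b, siteEnergy S j (x ⊓ y)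
        + ∑ j ∈ Finset.Ico c b, siteEnergy S j (x ⊔ y)
        ≤ ∑ j ∈ Finset.Ico c b, siteEnergy S j x + ∑ j ∈ Finset.Ico c b, siteEnergy S j y := by
      rw [← Finset.sum_add_distrib, ← Finset.sum_add_distrib]
      exact Finset.sum_le_sum fun j _ => hS.siteEnergy_inf_add_sup_le j x y
    have s14 := sum_Ico_add_sum_Ico (fun j => siteEnergy S j x) (show c ≤ b by omega)
      (show b ≤ e by omega)
    have s15 := sum_Ico_add_sum_Ico (fun j => siteEnergy S j y) (show b - n * p ≤ c by omega)
      (show c ≤ b by omega)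
    have s16 := hS.sum_periods hp hy.1 (b - n * p) n
    rw [sub_add_cancel] at s16
    have s8z := s8 z'
    have s8w := s8 (x ⊓ y)
    linarith
  have lim1 : Tendsto (fun m : ℕ => translate (-(m * p)) (-(m * q)) x) atTop (𝓝 xm) := by
    refine tendsto_pi_nhds.2 fun i => (tm i).congr fun m => ?_
    simp only [translate, sub_neg_eq_add]
    push_cast
    ring
  have lim2 : Tendsto (fun m : ℕ => translate (-(m * p)) (-(m * q)) (X m)) atTop (𝓝 xm) := by
    refine tendsto_pi_nhds.2 fun i => ?_
    rcases le_or_gt i 0 with hi | hi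
    -- Left of the cut, the shifted competitor is the translate of `x` by `m - n` periods, so it has
    -- the same limit.
    · refine ((tm i).comp (tendsto_sub_atTop_nat n)).congr' ?_
      filter_upwards [(tendsto_natCast_mul_atTop hp).eventually_ge_atTop (b + 1 + n * p - i), eventually_ge_atTop n]
        with m hm hnm
      simp only [translate, sub_neg_eq_add, hX, Function.comp, hT]
      have hnp : 0 ≤ n * p := by positivity
      rw [if_pos (by omega), if_neg (by omega), hzb' _ (by omega)]
      push_cast [Nat.cast_sub hnm]
      rw [show i + (m - n) * p = i + m * p - n * p by ring]
      ring
    · refine (tm i).congr fun m => ?_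
      simp only [translate, sub_neg_eq_add, hX]
      rw [if_neg (by omega)]
      push_cast
      ring
  have hcont : ∀ s : ℤ, Continuous fun u : ℤ → ℝ => ∑ j ∈ Finset.Ico s 1, siteEnergy S j u :=
    fun s => continuous_finsetSum _ fun j _ => hS.continuous_siteEnergy j
  have hfin := le_of_tendsto_of_tendsto (((hcont _).tendsto xm).comp lim1)
    (((((hcont _).tendsto xm).comp lim2).const_add _).sub_const _) hkey
  have hnp : 0 ≤ n * p := by positivity
  have f1 := hS.sum_periods hp hxm.1 (-(n * p) - r + 1) n
  rw [show (-(n * p) - r + 1 + n * p : ℤ) = -r + 1 by ring] at f1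
  have f2 := sum_Ico_add_sum_Ico (fun j => siteEnergy S j xm)
    (show (-(n * p) - r + 1 : ℤ) ≤ -r + 1 by omega) (show (-r + 1 : ℤ) ≤ 1 by omega)
  -- Equal minimal actions cancel the `n` periods, and the end terms agree in the limit, leaving a
  -- nonpositive saving against `ht`.
  have f3 : action S 1 p xm = action S 1 p y := le_antisymm (hxm.2 y hy.1) (hy.2 xm hxm.1)
  rw [f3] at f1
  linarith

end Gap

end AubryMather

theorem mainTheorem7 (r : ℕ) (S : (Fin (r + 1) → ℝ) → ℝ) (hS : AubryMather.IsLocalEnergy r S)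
    (p q : ℤ) (hp : 0 < p) (x : ℤ → ℝ)
    (hx : x ∈ AubryMather.birkhoffMinimizersPlus S p q)
    (hxp : x ∉ AubryMather.periodicMinimizers S p q) :
    ∃ xm ∈ AubryMather.periodicMinimizers S p q, ∃ xp ∈ AubryMather.periodicMinimizers S p q,
      Tendsto (fun n : ℕ => (AubryMather.translate p q)^[n] x) atTop (𝓝 xp) ∧
      Tendsto (fun n : ℕ => (AubryMather.translate (-p) (-q))^[n] x) atTop (𝓝 xm) ∧
      ¬ ∃ y ∈ AubryMather.periodicMinimizers S p q, xm < y ∧ y < xp := by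
  obtain ⟨hglob, hB, hR, hle⟩ := hx
  obtain ⟨⟨xp, htp⟩, ⟨xm, htm⟩⟩ := AubryMather.exists_tendsto_translate hp hB hR hle
  have hxpM := hS.limit_mem_periodicMinimizers hp hglob htp
    (AubryMather.mem_periodicSeqs_of_tendsto htp)
  have hxmM := hS.limit_mem_periodicMinimizers hp hglob htm
    (AubryMather.periodicSeqs_neg (AubryMather.mem_periodicSeqs_of_tendsto htm))
  refine ⟨xm, hxmM, xp, hxpM, htp, htm, ?_⟩
  rintro ⟨y, hy, hmy, hyp⟩
  refine hS.not_between hp hglob hxmM hxpM (fun i => ?_) (fun i => ?_) hy hmy hyp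
  · refine (tendsto_pi_nhds.1 htp i).congr fun m => ?_
    simp [AubryMather.translate_iterate, AubryMather.translate]
  · refine (tendsto_pi_nhds.1 htm i).congr fun m => ?_
    simp [AubryMather.translate_iterate, AubryMather.translate, sub_eq_add_neg]
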